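/- Let $K$ be prefix-free Kolmogorov complexity with respect to a universal (additively optimal) prefix-free machine, and let $x=x_1x_2\ldots\in\{0,1\}^\infty$ be incompressible, i.e. there is a constant $c$ with $K(x_1\ldots x_n)\ge n-c$ for all $n$. For $k\ge 0$ let $$u_k=x_{2^{2^k}-1}\,x_{2^{2^k}}\ldots x_{2^{2^{k+1}}-2},\qquad y=y(x)=u_0u_0u_1u_1u_2u_2\ldots,$$ and let $n_k=|u_0u_0\ldots u_ku_k|=2\,(2^{2^{k+1}}-2)$. For a probability measure $\mu$ on $\{0,1\}^\infty$, call a sequence $\mu$-typical if for every word $u\in\{0,1\}^*$ the limiting frequency of occurrences of $u$ in the sequence exists and equals $\mu(u)$, the measure of the set of sequences that begin with $u$. Let $C$ be a prefix code for the non-negative integers with $|C(m)|=\log_2 m+2\log_2\log_2(m+1)+O(1)$ for $m\ge1$. The LZ77 code $\varphi$ parses a word greedily from left to right into pairs $(p_1;l_1),\ldots,(p_s;l_s)$ and outputs $C(p_1)C(l_1)\ldots C(p_s)C(l_s)$: a letter $a$ that does not occur in the part already parsed gives the pair $(0;a)$; otherwise the next pair $(p;l)$ represents the longest prefix of the remaining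 word that occurs within the part already parsed, namely its $l$ letters beginning at position $p$ (any such occurrence may be chosen). The test at significance level $\alpha$ rejects a word $w$ of length $n$ if $n-|\varphi(w)|\ge\log_2(1/\alpha)$. Then: 1. $y$ is not $\mu$-typical for any stationary ergodic measure $\mu$ other than the Bernoulli measure $B(1/2,1/2)$ of independent fair bits; 2. for every $\alpha\in(0,1)$ the test with the LZ77 code rejects $y$ in the sense that it rejects the initial segment $y_1\ldots y_{n_k}=u_0u_0\ldots u_ku_k$ for all sufficiently large $k$. -/

import Mathlib

open MeasureTheory Filter Topology

namespace LZTest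

/-! ## Binary sequences. The paper's `x₁ x₂ x₃ …` is `x 0, x 1, x 2, …` here. -/

/-- The word `x i, x (i+1), …, x (i+l-1)`. -/
def block (x : ℕ → Bool) (i l : ℕ) : List Bool :=
  (List.range l).map fun j => x (i + j)

/-- The first `n` letters of `x`. -/
def initial (x : ℕ → Bool) (n : ℕ) : List Bool := block x 0 n

/-! ## Prefix-free Kolmogorov complexity -/

/-- A prefix-free machine: a partial recursive map on binary words, no program on which it halts
being a proper prefix of another one. -/
def IsPrefixMachine (M : List Bool →. List Bool) : Prop :=
  Partrec M ∧ ∀ p q : List Bool, (M p).Dom → (M q).Dom → p <+: q → p = q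

/-- The complexity of `s` relative to `M`: the length of a shortest program on which `M` outputs
`s`, and `⊤` if there is none. -/
noncomputable def complexity (M : List Bool →. List Bool) (s : List Bool) : ℕ∞ :=
  ⨅ (p : List Bool) (_ : s ∈ M p), (p.length : ℕ∞)

/-- A universal prefix-free machine: a prefix-free machine whose complexity is, up to an additive
constant, minimal among all prefix-free machines. -/
def IsUniversalPrefixMachine (U : List Bool →. List Bool) : Prop :=
  IsPrefixMachine U ∧
    ∀ M : List Bool →. List Bool, IsPrefixMachine M →
      ∃ c : ℕ, ∀ s : List Bool, complexity U s ≤ complexity M s + (c : ℕ∞)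

/-- `x` is incompressible (algorithmically random): `K (x₁ … xₙ) ≥ n - c` for some `c` and all
`n`, where `K` is the prefix-free complexity given by `U`. -/
def Incompressible (U : List Bool →. List Bool) (x : ℕ → Bool) : Prop :=
  ∃ c : ℕ, ∀ n : ℕ, (n : ℕ∞) ≤ complexity U (initial x n) + (c : ℕ∞)

/-! ## Stationary ergodic measures and typical sequences -/

/-- The shift on one-sided binary sequences. -/
def shift (z : ℕ → Bool) : ℕ → Bool := fun n => z (n + 1)

/-- A stationary ergodic measure: a shift-invariant ergodic probability measure. -/
def IsStationaryErgodic (μ : Measure (ℕ → Bool)) : Prop :=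
  IsProbabilityMeasure μ ∧ Ergodic shift μ

/-- The Bernoulli measure `B(1/2, 1/2)` (independent fair bits). -/
noncomputable def fairCoin : Measure (ℕ → Bool) :=
  Measure.infinitePi fun _ : ℕ => (PMF.uniformOfFintype Bool).toMeasure

/-- The number of occurrences of `u` in `z` that start at one of the first `n` positions. -/
def occurrences (z : ℕ → Bool) (u : List Bool) (n : ℕ) : ℕ :=
  ((Finset.range n).filter fun i => block z i u.length = u).card

/-- `z` is `μ`-typical: the limiting frequency of every word `u` in `z` exists and is `μ(u)`, the
measure of the set of sequences that begin with `u`. -/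
def IsTypical (μ : Measure (ℕ → Bool)) (z : ℕ → Bool) : Prop :=
  ∀ u : List Bool,
    Tendsto (fun n : ℕ => (occurrences z u n : ℝ) / (n : ℝ)) atTop
      (𝓝 (μ.real {w | initial w u.length = u}))

/-! ## The sequence `y(x) = u₀ u₀ u₁ u₁ u₂ u₂ …` -/

/-- `u_k = x_{2^{2^k}-1} … x_{2^{2^{k+1}}-2}` (indices from `1`). -/
def blockU (x : ℕ → Bool) (k : ℕ) : List Bool :=
  block x (2 ^ 2 ^ k - 2) (2 ^ 2 ^ (k + 1) - 2 ^ 2 ^ k)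

/-- The word `u₀ u₀ u₁ u₁ … u_k u_k`. -/
def doubledWord (x : ℕ → Bool) (k : ℕ) : List Bool :=
  (List.range (k + 1)).flatMap fun j => blockU x j ++ blockU x j

/-- The infinite sequence `y(x) = u₀ u₀ u₁ u₁ …`: its `n`-th letter is read off
`u₀ u₀ … u_n u_n`, which has more than `n` letters. -/
def doubled (x : ℕ → Bool) : ℕ → Bool := fun n => (doubledWord x n).getD n false

/-! ## The LZ77 code -/

/-- `LZ77Parse done rest ps`: when the prefix `done` has already been represented, the remaining
word `rest` is represented by the list of pairs `ps`, found greedily from left to right.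
A letter that does not occur in `done` gives the pair `(0; a)`. Otherwise the pair `(p; l)`
represents the longest prefix of `rest` that occurs in `done`, namely the `l` letters of `done`
beginning at the position `p` (counted from `1`; any such occurrence may be used). -/
inductive LZ77Parse : List Bool → List Bool → List (ℕ × ℕ) → Prop
  | nil (done : List Bool) : LZ77Parse done [] []
  | literal (done : List Bool) (a : Bool) (rest : List Bool) (ps : List (ℕ × ℕ)) :
      a ∉ done → LZ77Parse (done ++ [a]) rest ps →
      LZ77Parse done (a :: rest) ((0, a.toNat) :: ps)
  | copy (done v rest : List Bool) (p : ℕ) (ps : List (ℕ × ℕ)) :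
      v ≠ [] → v <+: done.drop p →
      (∀ a : Bool, [a] <+: rest → ¬ (v ++ [a]) <:+: done) →
      LZ77Parse (done ++ v) rest ps →
      LZ77Parse done (v ++ rest) ((p + 1, v.length) :: ps)

/-- A prefix code `C` for the integers with `|C(m)| = log m + 2 log log (m + 1) + O(1)`. -/
def IsIntegerCode (C : ℕ → List Bool) : Prop :=
  (∀ m m' : ℕ, C m <+: C m' → m = m') ∧
    ∃ c : ℝ, ∀ m : ℕ, 1 ≤ m →
      |((C m).length : ℝ) - (Real.logb 2 m + 2 * Real.logb 2 (Real.logb 2 ((m : ℝ) + 1)))| ≤ c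

/-- The codeword `C(p₁) C(l₁) … C(p_s) C(l_s)` of a list of pairs. -/
def encodePairs (C : ℕ → List Bool) (ps : List (ℕ × ℕ)) : List Bool :=
  ps.flatMap fun q => C q.1 ++ C q.2

/-- `φ` is an LZ77 code with integer code `C`: every word is mapped to the codeword of an LZ77
list of pairs representing it. -/
def IsLZ77Code (C : ℕ → List Bool) (φ : List Bool → List Bool) : Prop :=
  ∀ w : List Bool, ∃ ps : List (ℕ × ℕ), LZ77Parse [] w ps ∧ φ w = encodePairs C ps

/-- The test with code `φ` and significance level `α` rejects the word `w = w₁ … wₙ`: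
`n - |φ(w)| ≥ - log₂ α`. -/
def Rejects (φ : List Bool → List Bool) (α : ℝ) (w : List Bool) : Prop :=
  -Real.logb 2 α ≤ (w.length : ℝ) - ((φ w).length : ℝ)

end LZTest

open LZTest

open LZTest

namespace LZTest

/-! Identification of the measure. For a fixed word `r`, the signed difference between the numbers
of letters 0 and 1 following `r` is, over uniformly random words of length n, a martingale with
steps at most 1, so its second moment is at most n (`sum_sq_imbalance_le`). By Chebyshev only O(2^n
/ n) words have a difference above n/m. For n = 2^2^k such a word is described by k in unary and an
index of n - 2^k + O(1) bits, which an incompressible sequence forbids for large k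
(`Incompressible.eventually_imbalance_le`). Up to the end of the first copy of a block, `doubled x`
is a shifted piece of `x` plus a negligible beginning (`occurrences_doubled_le`). Along these
lengths the words w0 and w1 have asymptotically equal frequencies, so typicality forces μ(w0) =
μ(w1) for all w, and these equalities determine the fair coin (`eq_fairCoin`).

Rejection. Once the first copy of the last block is parsed, the rest already occurs, so one further
pair finishes the word. Before that, each pair either copies at least t letters or makes a new word
of length at most t occur (`LZ77Parse.mul_length_le`). With N = 2^2^(k+2) and t = (3/4) log N, the
O(2^t) short words are negligible and there are about N/t pairs. Their positions cost about (3/2)N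
bits and their lengths at most N/4, against 2N letters; the gap grows without bound. -/

/-! ### Words of a given length -/

/-- All binary words of length `n`. -/
def words : ℕ → List (List Bool)
  | 0 => [[]]
  | n + 1 => (words n).flatMap fun s => [false :: s, true :: s]

theorem mem_words {n : ℕ} {s : List Bool} : s ∈ words n ↔ s.length = n := by
  induction n generalizing s with
  | zero => simp [words]
  | succ n ih =>
    simp only [words, List.mem_flatMap, List.mem_cons, List.not_mem_nil, or_false, ih]
    constructor
    · rintro ⟨t, rfl, rfl | rfl⟩ <;> rfl
    · intro h
      match s, h with
      | false :: t, h => exact ⟨t, by simpa using h, .inl rfl⟩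
      | true :: t, h => exact ⟨t, by simpa using h, .inr rfl⟩

theorem sum_map_words_succ {M : Type*} [AddCommMonoid M] (f : List Bool → M) (n : ℕ) :
    ((words (n + 1)).map f).sum = ((words n).map fun s => f (false :: s) + f (true :: s)).sum := by
  rw [words]
  induction words n with
  | nil => simp
  | cons s l ih => simp [ih, add_assoc]

theorem length_words (n : ℕ) : (words n).length = 2 ^ n := by
  induction n with
  | zero => rfl
  | succ n ih => simp [words, ih, List.length_flatMap, pow_succ]

theorem nodup_words (n : ℕ) : (words n).Nodup := by
  induction n with
  | zero => simp [words]
  | succ n ih =>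
    rw [words, List.nodup_flatMap]
    refine ⟨fun s _ => by simp, ?_⟩
    refine ih.imp fun {s t} hst => ?_
    simp [Function.onFun, List.disjoint_left, hst]

theorem primrec_words : Primrec words := by
  refine (Primrec.nat_rec₁ (f := fun _ L => L.flatMap fun s => [false :: s, true :: s])
    [[]] ?_).of_eq fun n => ?_
  · refine Primrec.list_flatMap Primrec.snd ?_
    refine Primrec.list_cons.comp ?_ (Primrec.list_cons.comp ?_ (Primrec.const []))
    · exact Primrec.list_cons.comp (Primrec.const false) Primrec.snd
    · exact Primrec.list_cons.comp (Primrec.const true) Primrec.snd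
  · induction n with
    | zero => rfl
    | succ n ih => simp only [words, ← ih]

/-! ### A prefix-free machine that indexes a computable family of lists of words -/

/-- On `1ᵏ 0 q` with `|q| = ℓ k`, output the word of `B k` whose index is that of `q`. -/
def indexMachine (B : ℕ → List (List Bool)) (ℓ : ℕ → ℕ) (p : List Bool) : Option (List Bool) :=
  if p.length = p.idxOf false + 1 + ℓ (p.idxOf false) then
    (B (p.idxOf false))[(words (ℓ (p.idxOf false))).idxOf (p.drop (p.idxOf false + 1))]?
  else none

theorem primrec_indexMachine {B : ℕ → List (List Bool)} {ℓ : ℕ → ℕ} (hB : Primrec B)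
    (hℓ : Primrec ℓ) : Primrec (indexMachine B ℓ) := by
  have hk : Primrec fun p : List Bool => p.idxOf false :=
    Primrec.list_idxOf.comp (Primrec.const false) Primrec.id
  refine Primrec.ite ?_ ?_ (Primrec.const none)
  · exact Primrec.eq.comp Primrec.list_length
      (Primrec.nat_add.comp (Primrec.succ.comp hk) (hℓ.comp hk))
  · refine Primrec.list_getElem?.comp (hB.comp hk) ?_
    refine (Primrec.list_idxOf.comp (Primrec.list_drop.comp (Primrec.succ.comp hk) Primrec.id)
      (primrec_words.comp (hℓ.comp hk))).of_eq fun p => ?_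
    congr 1
    exact lawful_beq_subsingleton _ _

/-- The header, ones closed by the first zero, fixes the total length of a halting program; two
comparable programs share the header and hence the length. -/
theorem isPrefixMachine_indexMachine {B : ℕ → List (List Bool)} {ℓ : ℕ → ℕ} (hB : Primrec B)
    (hℓ : Primrec ℓ) : IsPrefixMachine fun p => (indexMachine B ℓ p : Part (List Bool)) := by
  refine ⟨Computable.ofOption (primrec_indexMachine hB hℓ).to_comp, fun p q hp hq hpq => ?_⟩
  have len : ∀ p : List Bool, (indexMachine B ℓ p : Part (List Bool)).Dom →
      p.length = p.idxOf false + 1 + ℓ (p.idxOf false) := by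
    intro p hp
    by_contra h
    simp [indexMachine, h] at hp
  have h1 := len p hp
  have h2 := len q hq
  obtain ⟨t, rfl⟩ := hpq
  -- Without a zero, `idxOf` would return the full length, against the length equation.
  have hmem : false ∈ p := List.idxOf_lt_length_iff.1 (by omega)
  rw [List.idxOf_append_of_mem hmem] at h2
  have : t.length = 0 := by rw [List.length_append] at h2; omega
  rw [List.length_eq_zero_iff.1 this, List.append_nil]

theorem complexity_indexMachine_le {B : ℕ → List (List Bool)} {ℓ : ℕ → ℕ} {k : ℕ}
    (hk : (B k).length ≤ 2 ^ ℓ k) {s : List Bool} (hs : s ∈ B k) :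
    complexity (fun p => (indexMachine B ℓ p : Part (List Bool))) s
      ≤ ((k + 1 + ℓ k : ℕ) : ℕ∞) := by
  obtain ⟨i, hi, rfl⟩ := List.mem_iff_getElem.1 hs
  have hi' : i < (words (ℓ k)).length := by rw [length_words]; omega
  set q := (words (ℓ k))[i] with hq
  have hql : q.length = ℓ k := mem_words.1 (List.getElem_mem hi')
  have hidx : (List.replicate k true ++ false :: q).idxOf false = k := by
    rw [List.idxOf_append_of_notMem (by simp)]
    simp
  have hlen : (List.replicate k true ++ false :: q).length = k + 1 + ℓ k := by
    simp [hql]; omega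
  have hdrop : (List.replicate k true ++ false :: q).drop (k + 1) = q := by
    rw [List.drop_append]; simp
  refine (iInf₂_le (List.replicate k true ++ false :: q) ?_).trans (by rw [hlen])
  rw [Part.mem_ofOption]
  simp only [indexMachine, hidx, hlen, if_true, hdrop]
  rw [hq, (nodup_words _).idxOf_getElem, List.getElem?_eq_getElem hi]
  rfl

/-! ### Unbalanced words are rare -/

/-- The number of letters `a` of the reversed word `s` that are preceded by the reversed
word `r`. -/
def hitCount (r : List Bool) (a : Bool) : List Bool → ℕ
  | [] => 0
  | b :: s => hitCount r a s + if b = a ∧ s.take r.length = r then 1 else 0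

theorem primrec_hitCount (r : List Bool) (a : Bool) : Primrec (hitCount r a) := by
  refine (Primrec.list_rec (f := id) (g := fun _ => 0)
    (h := fun _ (t : Bool × List Bool × ℕ) =>
      t.2.2 + if t.1 = a ∧ t.2.1.take r.length = r then 1 else 0)
    Primrec.id (Primrec.const 0) ?_).of_eq fun s => ?_
  · refine Primrec.nat_add.comp (Primrec.snd.comp (Primrec.snd.comp Primrec.snd)) ?_
    refine Primrec.ite (PrimrecPred.and ?_ ?_) (Primrec.const 1) (Primrec.const 0)
    · exact Primrec.eq.comp (Primrec.fst.comp Primrec.snd) (Primrec.const a)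
    · exact Primrec.eq.comp (Primrec.list_take.comp (Primrec.const _)
        (Primrec.fst.comp (Primrec.snd.comp Primrec.snd))) (Primrec.const r)
  · induction s with
    | nil => rfl
    | cons b s ih => simp only [hitCount, ← ih]; rfl

/-- The distance between the numbers of zeros and ones that are preceded by `r`. -/
def imbalance (r s : List Bool) : ℕ :=
  (hitCount r false s - hitCount r true s) + (hitCount r true s - hitCount r false s)

theorem cast_imbalance (r s : List Bool) :
    (imbalance r s : ℤ) = |(hitCount r false s : ℤ) - hitCount r true s| := by
  unfold imbalance
  rcases abs_cases ((hitCount r false s : ℤ) - hitCount r true s) with h | h <;> omega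

theorem primrec_imbalance (r : List Bool) : Primrec (imbalance r) :=
  Primrec.nat_add.comp
    (Primrec.nat_sub.comp (primrec_hitCount r false) (primrec_hitCount r true))
    (Primrec.nat_sub.comp (primrec_hitCount r true) (primrec_hitCount r false))

theorem sum_sq_imbalance_le (r : List Bool) (n : ℕ) :
    ((words n).map fun s => (imbalance r s : ℤ) ^ 2).sum ≤ n * 2 ^ n := by
  induction n with
  | zero => simp [words, imbalance, hitCount]
  | succ n ih =>
    -- With signed difference D, the two extensions give D + 1 and D - 1 if `s` begins with `r`, and
    -- D twice otherwise; (D+1)² + (D-1)² = 2D² + 2.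
    have key : ∀ s : List Bool, (imbalance r (false :: s) : ℤ) ^ 2
        + (imbalance r (true :: s) : ℤ) ^ 2 ≤ 2 * (imbalance r s : ℤ) ^ 2 + 2 := by
      intro s
      simp only [cast_imbalance, sq_abs, hitCount]
      by_cases h : s.take r.length = r
      · simp [h]; nlinarith
      · simp [h]; nlinarith
    rw [sum_map_words_succ]
    calc _ ≤ ((words n).map fun s => 2 * (imbalance r s : ℤ) ^ 2 + 2).sum :=
          List.sum_le_sum fun s _ => key s
      _ = 2 * ((words n).map fun s => (imbalance r s : ℤ) ^ 2).sum + 2 * 2 ^ n := by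
          rw [List.sum_map_add, List.sum_map_mul_left]
          simp [length_words, mul_comm]
      _ ≤ _ := by push_cast; rw [pow_succ]; nlinarith

/-- The words `s` of length `n`, written backwards, with `m * imbalance r s > n`. -/
def unbalanced (r : List Bool) (m n : ℕ) : List (List Bool) :=
  (words n).filter fun s => n < m * imbalance r s

/-- Chebyshev's inequality applied to the second moment bound, with one factor n cancelled. -/
theorem length_unbalanced_mul_le (r : List Bool) (m : ℕ) {n : ℕ} (hn : 0 < n) :
    (unbalanced r m n).length * n ≤ m ^ 2 * 2 ^ n := by
  have h1 : ∀ L : List (List Bool), ((L.filter fun s => n < m * imbalance r s).length : ℤ) * n ^ 2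
      ≤ m ^ 2 * (L.map fun s => (imbalance r s : ℤ) ^ 2).sum := by
    intro L
    induction L with
    | nil => simp
    | cons s L ih =>
      by_cases h : n < m * imbalance r s
      · have h' : (n : ℤ) ^ 2 ≤ (m * imbalance r s) ^ 2 := by
          have : (n : ℤ) ≤ m * imbalance r s := by exact_mod_cast h.le
          gcongr
        simp only [List.filter_cons, h, decide_true, if_true, List.length_cons, List.map_cons,
          List.sum_cons]
        push_cast
        nlinarith
      · simp only [List.filter_cons, h, decide_false, List.map_cons,
          List.sum_cons]
        have : (0 : ℤ) ≤ m ^ 2 * imbalance r s ^ 2 := by positivity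
        simp only [Bool.false_eq_true, if_false]
        nlinarith
  have h2 := (h1 (words n)).trans
    (mul_le_mul_of_nonneg_left (sum_sq_imbalance_le r n) (by positivity))
  have h3 : (unbalanced r m n).length * n * n ≤ m ^ 2 * 2 ^ n * n := by
    have : ((unbalanced r m n).length : ℤ) * n ^ 2 ≤ m ^ 2 * (n * 2 ^ n) := h2
    zify
    linarith
  exact Nat.le_of_mul_le_mul_right h3 hn

theorem primrec_two_pow : Primrec fun n : ℕ => 2 ^ n := by
  refine (Primrec.nat_rec₁ (f := fun _ v => v * 2) 1
    (Primrec.nat_mul.comp Primrec.snd (Primrec.const 2))).of_eq fun n => ?_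
  induction n with
  | zero => rfl
  | succ n ih => simp only [pow_succ, ← ih]

theorem primrec_unbalanced (r : List Bool) (m : ℕ) : Primrec (unbalanced r m) := by
  have hR : PrimrecRel fun (s : List Bool) (n : ℕ) => n < m * imbalance r s :=
    Primrec.nat_lt.comp Primrec.snd
      (Primrec.nat_mul.comp (Primrec.const m) ((primrec_imbalance r).comp Primrec.fst))
  exact hR.listFilter.comp primrec_words Primrec.id

/-- The initial segments of length `2 ^ 2 ^ k` of an incompressible sequence are eventually
balanced. -/
theorem Incompressible.eventually_imbalance_le {U : List Bool →. List Bool}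
    (hU : IsUniversalPrefixMachine U) {x : ℕ → Bool} (hx : Incompressible U x) (r : List Bool)
    (m : ℕ) : ∀ᶠ k in atTop, m * imbalance r (initial x (2 ^ 2 ^ k)).reverse ≤ 2 ^ 2 ^ k := by
  have hN : Primrec fun k : ℕ => 2 ^ 2 ^ k := primrec_two_pow.comp primrec_two_pow
  let B : ℕ → List (List Bool) := fun k => (unbalanced r m (2 ^ 2 ^ k)).map List.reverse
  -- For N = 2^2^k this is log₂(2^N / N) + 2m; the Chebyshev factor m² is absorbed by 2^(2m).
  let ℓ : ℕ → ℕ := fun k => 2 ^ 2 ^ k - 2 ^ k + 2 * m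
  have hB : Primrec B := Primrec.list_map ((primrec_unbalanced r m).comp hN)
    (Primrec.list_reverse.comp Primrec.snd)
  have hℓ : Primrec ℓ :=
    Primrec.nat_add.comp (Primrec.nat_sub.comp hN primrec_two_pow) (Primrec.const _)
  have hlt : ∀ k : ℕ, 2 ^ k ≤ 2 ^ 2 ^ k := fun k => (Nat.lt_two_pow_self).le
  have hBℓ : ∀ k, (B k).length ≤ 2 ^ ℓ k := by
    intro k
    have h1 := length_unbalanced_mul_le r m (n := 2 ^ 2 ^ k) (by positivity)
    have h2 : m ^ 2 ≤ 2 ^ (2 * m) := by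
      rw [mul_comm, pow_mul]
      exact Nat.pow_le_pow_left (Nat.lt_two_pow_self).le 2
    have h3 : (B k).length * 2 ^ 2 ^ k ≤ 2 ^ ℓ k * 2 ^ 2 ^ k := by
      calc (B k).length * 2 ^ 2 ^ k ≤ m ^ 2 * 2 ^ 2 ^ 2 ^ k := by simpa [B] using h1
        _ ≤ 2 ^ (2 * m) * 2 ^ 2 ^ 2 ^ k := Nat.mul_le_mul_right _ h2
        _ = 2 ^ ℓ k * 2 ^ 2 ^ k := by
          rw [← pow_add, ← pow_add]
          congr 1
          have := hlt k
          simp only [ℓ]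
          omega
    exact Nat.le_of_mul_le_mul_right h3 (by positivity)
  obtain ⟨c, hc⟩ := hx
  obtain ⟨d, hd⟩ := hU.2 _ (isPrefixMachine_indexMachine hB hℓ)
  filter_upwards [eventually_gt_atTop (1 + 2 * m + d + c)] with k hk
  by_contra hlarge
  have hmem : initial x (2 ^ 2 ^ k) ∈ B k := by
    refine List.mem_map.2 ⟨(initial x (2 ^ 2 ^ k)).reverse, ?_, List.reverse_reverse _⟩
    refine List.mem_filter.2 ⟨mem_words.2 (by simp [initial, block]), ?_⟩
    simpa using hlarge
  have h1 := (hc (2 ^ 2 ^ k)).trans (add_le_add_left ((hd _).trans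
    (add_le_add_left (complexity_indexMachine_le (hBℓ k) hmem) _)) _)
  have h2 : 2 ^ 2 ^ k ≤ k + 1 + ℓ k + d + c := by exact_mod_cast h1
  have h3 := hlt k
  -- The descriptions force 2^k ≤ k + 1 + 2m + d + c, while the choice of `k` makes the right side
  -- smaller than 2k.
  have h4 : 2 * k ≤ 2 ^ k := by
    obtain ⟨j, rfl⟩ : ∃ j, k = j + 1 := ⟨k - 1, by omega⟩
    have : j < 2 ^ j := Nat.lt_two_pow_self
    rw [pow_succ]; omega
  simp only [ℓ] at h2
  omega

/-! ### Blocks and occurrences -/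

@[simp]
theorem length_block (x : ℕ → Bool) (i l : ℕ) : (block x i l).length = l := by simp [block]

theorem block_add (x : ℕ → Bool) (i a b : ℕ) :
    block x i (a + b) = block x i a ++ block x (i + a) b := by
  simp [block, List.range_add, Function.comp_def, add_assoc]

theorem block_one (x : ℕ → Bool) (i : ℕ) : block x i 1 = [x i] := by simp [block]

theorem getElem?_block {x : ℕ → Bool} {i l j : ℕ} (h : j < l) :
    (block x i l)[j]? = some (x (i + j)) := by
  simp [block, h]

theorem hitCount_eq_zero {r : List Bool} {a : Bool} {s : List Bool} (h : s.length ≤ r.length) :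
    hitCount r a s = 0 := by
  induction s with
  | nil => rfl
  | cons b s ih =>
    have h' : s.length < r.length := by simpa using h
    have : s.take r.length ≠ r := by
      intro e
      have := congrArg List.length e
      rw [List.length_take] at this
      omega
    simp [hitCount, ih h'.le, this]

theorem occurrences_succ (z : ℕ → Bool) (u : List Bool) (n : ℕ) :
    occurrences z u (n + 1) = occurrences z u n + if block z n u.length = u then 1 else 0 := by
  unfold occurrences
  rw [Finset.range_add_one, Finset.filter_insert]
  split_ifs with h
  · rw [Finset.card_insert_of_notMem (by simp)]
  · rfl

/-- `hitCount` recurses on the latest letter, hence the reversals. An occurrence is counted at its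
last letter, `w.length` places after its start. -/
theorem hitCount_reverse_initial (x : ℕ → Bool) (w : List Bool) (a : Bool) (n : ℕ) :
    hitCount w.reverse a (initial x (n + w.length)).reverse = occurrences x (w ++ [a]) n := by
  induction n with
  | zero =>
    rw [hitCount_eq_zero (by simp [initial])]
    simp [occurrences]
  | succ n ih =>
    have h1 : (initial x (n + 1 + w.length)).reverse
        = x (n + w.length) :: (initial x (n + w.length)).reverse := by
      rw [show n + 1 + w.length = n + w.length + 1 by ring, initial, block_add, block_one]
      simp [initial]
    have h2 : (initial x (n + w.length)).reverse.take w.reverse.length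
        = (block x n w.length).reverse := by
      rw [initial, block_add, List.reverse_append, List.take_left']
      · simp
      · simp
    rw [h1, hitCount, ih, occurrences_succ, h2]
    congr 1
    simp only [List.length_append, List.length_singleton, block_add, block_one,
      List.reverse_inj]
    refine if_congr ?_ rfl rfl
    constructor
    · rintro ⟨h, h'⟩; rw [h, h']
    · intro h
      have := List.append_inj' h rfl
      exact ⟨by simpa using this.2, this.1⟩

theorem occurrences_add (z : ℕ → Bool) (u : List Bool) (a n : ℕ) :
    occurrences z u (a + n) = occurrences z u a + occurrences (fun i => z (a + i)) u n := by
  induction n with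
  | zero => simp [occurrences]
  | succ n ih =>
    rw [← add_assoc, occurrences_succ, ih, occurrences_succ, add_assoc]
    simp only [block, add_assoc]
    congr

theorem occurrences_le (z : ℕ → Bool) (u : List Bool) (n : ℕ) : occurrences z u n ≤ n :=
  (Finset.card_filter_le _ _).trans (by simp)

theorem occurrences_mono (z : ℕ → Bool) (u : List Bool) : Monotone (occurrences z u) :=
  monotone_nat_of_le_succ fun n => by rw [occurrences_succ]; omega

theorem occurrences_congr {z z' : ℕ → Bool} {u : List Bool} {n : ℕ}
    (h : ∀ i < n + u.length, z i = z' i) : occurrences z u n = occurrences z' u n := by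
  unfold occurrences
  congr 1
  refine Finset.filter_congr fun i hi => ?_
  have : block z i u.length = block z' i u.length := by
    refine List.map_congr_left fun j hj => h _ ?_
    simp only [Finset.mem_range, List.mem_range] at hi hj
    omega
  rw [this]

/-- Only occurrences starting in the last `u.length` positions can read beyond the range of
agreement. -/
theorem occurrences_le_of_eq {z z' : ℕ → Bool} {u : List Bool} {n : ℕ}
    (h : ∀ i < n, z i = z' i) : occurrences z u n ≤ occurrences z' u n + u.length := by
  rcases le_total n u.length with hn | hn
  · exact (occurrences_le z u n).trans (by omega)
  · obtain ⟨j, rfl⟩ := Nat.exists_eq_add_of_le' hn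
    have h1 := occurrences_le (fun i => z (j + i)) u u.length
    rw [occurrences_add, occurrences_congr h]
    have h2 := occurrences_mono z' u (Nat.le_add_right j u.length)
    omega

/-! ### The doubled sequence -/

theorem two_pow_two_pow_succ (k : ℕ) : 2 ^ 2 ^ (k + 1) = 2 ^ 2 ^ k * 2 ^ 2 ^ k := by
  rw [pow_succ 2 k, pow_mul, sq]

theorem two_le_two_pow_two_pow (k : ℕ) : 2 ≤ 2 ^ 2 ^ k := by
  calc 2 = 2 ^ 1 := rfl
    _ ≤ 2 ^ 2 ^ k := Nat.pow_le_pow_right (by norm_num) Nat.one_le_two_pow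

theorem two_pow_two_pow_le (k : ℕ) : 2 ^ 2 ^ k ≤ 2 ^ 2 ^ (k + 1) := by
  rw [two_pow_two_pow_succ]
  exact Nat.le_mul_self _

@[simp]
theorem length_blockU (x : ℕ → Bool) (k : ℕ) :
    (blockU x k).length = 2 ^ 2 ^ (k + 1) - 2 ^ 2 ^ k := length_block _ _ _

theorem doubledWord_succ (x : ℕ → Bool) (k : ℕ) :
    doubledWord x (k + 1) = doubledWord x k ++ blockU x (k + 1) ++ blockU x (k + 1) := by
  rw [doubledWord, List.range_succ, List.flatMap_append]
  simp [doubledWord]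

theorem length_doubledWord (x : ℕ → Bool) (k : ℕ) :
    (doubledWord x k).length = 2 * (2 ^ 2 ^ (k + 1) - 2) := by
  induction k with
  | zero => simp [doubledWord]
  | succ k ih =>
    have h1 := two_pow_two_pow_le (k + 1)
    have h2 := two_le_two_pow_two_pow (k + 1)
    rw [doubledWord_succ]
    simp only [List.length_append, ih, length_blockU]
    omega

theorem doubledWord_prefix (x : ℕ → Bool) {k l : ℕ} (h : k ≤ l) :
    doubledWord x k <+: doubledWord x l := by
  induction l, h using Nat.le_induction with
  | base => exact List.prefix_refl _
  | succ l _ ih =>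
    rw [doubledWord_succ, List.append_assoc]
    exact ih.trans (List.prefix_append _ _)

theorem lt_length_doubledWord (x : ℕ → Bool) (k : ℕ) : k < (doubledWord x k).length := by
  induction k with
  | zero => simp [length_doubledWord]
  | succ k ih =>
    have h1 := two_pow_two_pow_succ (k + 1)
    have h2 := two_le_two_pow_two_pow (k + 1)
    rw [length_doubledWord] at ih ⊢
    have h3 : 2 * 2 ^ 2 ^ (k + 1) ≤ 2 ^ 2 ^ (k + 1) * 2 ^ 2 ^ (k + 1) :=
      Nat.mul_le_mul_right _ h2
    omega

theorem getElem?_doubledWord {x : ℕ → Bool} {k n : ℕ} (h : n < (doubledWord x k).length) :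
    (doubledWord x k)[n]? = some (doubled x n) := by
  have hn := lt_length_doubledWord x n
  have key : (doubledWord x k)[n]? = (doubledWord x n)[n]? := by
    rcases le_total k n with hkn | hkn
    · obtain ⟨t, ht⟩ := doubledWord_prefix x hkn
      rw [← ht, List.getElem?_append_left h]
    · obtain ⟨t, ht⟩ := doubledWord_prefix x hkn
      rw [← ht, List.getElem?_append_left hn]
  rw [key, doubled, List.getD_eq_getElem _ _ hn, List.getElem?_eq_getElem hn]

theorem initial_doubled (x : ℕ → Bool) (k : ℕ) :
    initial (doubled x) (2 * (2 ^ 2 ^ (k + 1) - 2)) = doubledWord x k := by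
  rw [← length_doubledWord x k]
  refine List.ext_getElem? fun n => ?_
  rcases lt_or_ge n (doubledWord x k).length with h | h
  · rw [initial, getElem?_block h, getElem?_doubledWord h, zero_add]
  · rw [List.getElem?_eq_none h, List.getElem?_eq_none (by simpa [initial] using h)]

theorem doubled_add (x : ℕ → Bool) (k : ℕ) {i : ℕ}
    (hi : i < 2 ^ 2 ^ (k + 2) - 2 ^ 2 ^ (k + 1)) :
    doubled x (2 * (2 ^ 2 ^ (k + 1) - 2) + i) = x (2 ^ 2 ^ (k + 1) - 2 + i) := by
  rw [← length_doubledWord x k]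
  have hi' : i < (blockU x (k + 1)).length := by simpa using hi
  have h1 := getElem?_doubledWord (x := x) (k := k + 1) (n := (doubledWord x k).length + i)
    (by rw [doubledWord_succ]; simp only [List.length_append]; omega)
  rw [doubledWord_succ, List.append_assoc, List.getElem?_append_right (by omega),
    Nat.add_sub_cancel_left, List.getElem?_append_left hi', blockU, getElem?_block hi] at h1
  exact (Option.some.inj h1).symm

/-! ### Cylinders -/

theorem initial_succ (z : ℕ → Bool) (n : ℕ) : initial z (n + 1) = initial z n ++ [z n] := by
  rw [initial, block_add, block_one, zero_add, initial]

@[simp]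
theorem length_initial (z : ℕ → Bool) (n : ℕ) : (initial z n).length = n := length_block _ _ _

theorem initial_prefix (z : ℕ → Bool) {m n : ℕ} (h : m ≤ n) : initial z m <+: initial z n := by
  obtain ⟨k, rfl⟩ := Nat.exists_eq_add_of_le h
  rw [initial, initial, block_add]
  exact List.prefix_append _ _

/-- The set of the sequences that begin with `u`. -/
def cylinderSet (u : List Bool) : Set (ℕ → Bool) := {w | initial w u.length = u}

theorem cylinderSet_append_singleton (u : List Bool) (a : Bool) :
    cylinderSet (u ++ [a]) = cylinderSet u ∩ {z | z u.length = a} := by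
  ext z
  simp only [cylinderSet, Set.mem_ofPred_eq, List.length_append, List.length_singleton,
    initial_succ, Set.mem_inter_iff]
  constructor
  · intro h
    have := List.append_inj' h rfl
    exact ⟨this.1, by simpa using this.2⟩
  · rintro ⟨h, h'⟩
    rw [h, h']

theorem measurableSet_cylinderSet (u : List Bool) : MeasurableSet (cylinderSet u) := by
  induction u using List.reverseRecOn with
  | nil => simp [cylinderSet, initial, block]
  | append_singleton u a ih =>
    rw [cylinderSet_append_singleton]
    exact ih.inter (measurableSet_eq_fun (measurable_pi_apply _) measurable_const)

theorem cylinderSet_subset {u v : List Bool} (h : u <+: v) : cylinderSet v ⊆ cylinderSet u := by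
  intro z hz
  have h1 : initial z v.length = v := hz
  have h2 := List.prefix_of_prefix_length_le (initial_prefix z h.length_le)
    (h1.symm ▸ h) (by simp)
  exact h2.eq_of_length (by simp)

/-- Two prefixes of a common sequence are comparable, so intersecting cylinders are nested. -/
theorem isPiSystem_cylinderSet : IsPiSystem (Set.range cylinderSet) := by
  rintro _ ⟨u, rfl⟩ _ ⟨v, rfl⟩ ⟨z, hu, hv⟩
  have hu' : initial z u.length = u := hu
  have hv' : initial z v.length = v := hv
  rcases le_total u.length v.length with h | h
  · have := initial_prefix z h
    rw [hu', hv'] at this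
    rw [Set.inter_eq_right.2 (cylinderSet_subset this)]
    exact ⟨v, rfl⟩
  · have := initial_prefix z h
    rw [hu', hv'] at this
    rw [Set.inter_eq_left.2 (cylinderSet_subset this)]
    exact ⟨u, rfl⟩

theorem generateFrom_cylinderSet :
    MeasurableSpace.generateFrom (Set.range cylinderSet) = MeasurableSpace.pi := by
  apply le_antisymm
  · refine MeasurableSpace.generateFrom_le ?_
    rintro _ ⟨u, rfl⟩
    exact measurableSet_cylinderSet u
  · have hev : ∀ i : ℕ, @Measurable _ _ (MeasurableSpace.generateFrom (Set.range cylinderSet)) _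
        fun z : ℕ → Bool => z i := by
      intro i
      refine @measurable_to_countable' _ _ _ _ (_) _ fun b => ?_
      have : (fun z : ℕ → Bool => z i) ⁻¹' {b}
          = ⋃ u ∈ {u : List Bool | u.length = i}, cylinderSet (u ++ [b]) := by
        ext z
        simp only [Set.mem_preimage, Set.mem_singleton_iff, Set.mem_ofPred_eq, Set.mem_iUnion,
          cylinderSet_append_singleton]
        constructor
        · intro h
          exact ⟨initial z i, by simp, by simp [cylinderSet], by simpa using h⟩
        · rintro ⟨u, rfl, -, h⟩
          exact h
      rw [this]
      exact MeasurableSet.biUnion (Set.to_countable _) fun u _ =>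
        MeasurableSpace.measurableSet_generateFrom ⟨_, rfl⟩
    exact fun s hs => (@measurable_pi_iff _ _ _ (_) _ id).2 hev hs

theorem measureReal_cylinderSet_eq {μ : Measure (ℕ → Bool)} [IsProbabilityMeasure μ]
    (h : ∀ w, μ.real (cylinderSet (w ++ [false])) = μ.real (cylinderSet (w ++ [true])))
    (u : List Bool) : μ.real (cylinderSet u) = (1 / 2) ^ u.length := by
  induction u using List.reverseRecOn with
  | nil => simp [cylinderSet, initial, block]
  | append_singleton u a ih =>
    have hm : MeasurableSet {z : ℕ → Bool | z u.length = true} :=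
      measurableSet_eq_fun (measurable_pi_apply _) measurable_const
    have h1 := measureReal_inter_add_sdiff (μ := μ) (s := cylinderSet u) hm
    have h2 : cylinderSet u \ {z : ℕ → Bool | z u.length = true} = cylinderSet (u ++ [false]) := by
      rw [cylinderSet_append_singleton]
      ext z
      simp
    rw [h2, ← cylinderSet_append_singleton, ih, h u] at h1
    have h3 : μ.real (cylinderSet (u ++ [a])) = μ.real (cylinderSet (u ++ [true])) := by
      cases a
      · exact h u
      · rfl
    rw [h3, List.length_append, List.length_singleton, pow_succ]
    linarith

theorem fairCoin_cylinderSet (u : List Bool) : fairCoin (cylinderSet u) = (1 / 2) ^ u.length := by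
  have h : cylinderSet u
      = Set.pi (Finset.range u.length : Finset ℕ) fun i => ({u.getD i false} : Set Bool) := by
    ext z
    simp only [cylinderSet, Set.mem_ofPred_eq, Set.mem_pi, Finset.coe_range, Set.mem_Iio,
      Set.mem_singleton_iff]
    constructor
    · intro h i hi
      have h1 := getElem?_block (x := z) (i := 0) hi
      rw [← initial, h, zero_add] at h1
      simp [List.getD, h1]
    · intro h
      refine List.ext_getElem? fun i => ?_
      rcases lt_or_ge i u.length with hi | hi
      · rw [initial, getElem?_block hi, zero_add, h i hi, List.getD_eq_getElem _ _ hi,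
          List.getElem?_eq_getElem hi]
      · rw [List.getElem?_eq_none hi, List.getElem?_eq_none (by simpa using hi)]
  rw [h, fairCoin, Measure.infinitePi_pi _ fun _ _ => MeasurableSet.of_discrete]
  have : ∀ b : Bool, (PMF.uniformOfFintype Bool).toMeasure {b} = 1 / 2 := by
    intro b
    rw [PMF.toMeasure_apply_singleton _ _ MeasurableSet.of_discrete]
    simp
  simp [this]

instance : IsProbabilityMeasure fairCoin := by unfold fairCoin; infer_instance

/-- A probability measure for which every word is followed by `0` and by `1` with the same
probability is the measure of independent fair bits. -/
theorem eq_fairCoin {μ : Measure (ℕ → Bool)} [IsProbabilityMeasure μ]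
    (h : ∀ w, μ.real (cylinderSet (w ++ [false])) = μ.real (cylinderSet (w ++ [true]))) :
    μ = fairCoin := by
  refine ext_of_generate_finite (Set.range cylinderSet) generateFrom_cylinderSet.symm
    isPiSystem_cylinderSet ?_ (by simp)
  rintro _ ⟨u, rfl⟩
  have := measureReal_cylinderSet_eq h u
  rw [fairCoin_cylinderSet, ← ENNReal.ofReal_toReal (measure_ne_top μ (cylinderSet u))]
  rw [Measure.real] at this
  rw [this, ENNReal.ofReal_pow (by norm_num), ENNReal.ofReal_div_of_pos (by norm_num)]
  simp

/-! ### The doubled sequence is typical for no other measure -/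

/-- With N = 2^2^(k+2) and P = 2^2^(k+1), the first copy of block k + 1 ends in `doubled x` after
2(P-2) + (N-P) letters and in `x` after N - 2. The counts inside it agree up to boundary effects;
everything else has O(P) positions. -/
theorem occurrences_doubled_le (x : ℕ → Bool) (k : ℕ) (u : List Bool) :
    occurrences (doubled x) u (2 ^ 2 ^ (k + 2) + 2 ^ 2 ^ (k + 1) - 4)
      ≤ occurrences x u (2 ^ 2 ^ (k + 2)) + 2 * 2 ^ 2 ^ (k + 1) + u.length ∧
    occurrences x u (2 ^ 2 ^ (k + 2))
      ≤ occurrences (doubled x) u (2 ^ 2 ^ (k + 2) + 2 ^ 2 ^ (k + 1) - 4)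
        + 2 ^ 2 ^ (k + 1) + u.length := by
  have h1 := two_pow_two_pow_le (k + 1)
  have h2 := two_le_two_pow_two_pow (k + 1)
  have e : ∀ i < 2 ^ 2 ^ (k + 2) - 2 ^ 2 ^ (k + 1),
      doubled x (2 * (2 ^ 2 ^ (k + 1) - 2) + i) = x (2 ^ 2 ^ (k + 1) - 2 + i) :=
    fun i hi => doubled_add x k hi
  rw [show k + 1 + 1 = k + 2 from rfl] at h1
  generalize 2 ^ 2 ^ (k + 2) = N at *
  generalize 2 ^ 2 ^ (k + 1) = P at *
  have e1 : N + P - 4 = 2 * (P - 2) + (N - P) := by omega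
  have e2 : N = P - 2 + (N - P) + 2 := by omega
  have hy := occurrences_add (doubled x) u (2 * (P - 2)) (N - P)
  have hx := occurrences_add x u (P - 2) (N - P)
  have hx2 := occurrences_add x u (P - 2 + (N - P)) 2
  rw [← e1] at hy
  rw [← e2] at hx2
  have b1 := occurrences_le (doubled x) u (2 * (P - 2))
  have b2 := occurrences_le x u (P - 2)
  have b3 := occurrences_le (fun i => x (P - 2 + (N - P) + i)) u 2
  have b4 := occurrences_le_of_eq (u := u) e
  have b5 := occurrences_le_of_eq (u := u) fun i hi => (e i hi).symm
  omega

theorem measureReal_cylinderSet_of_isTypical {U : List Bool →. List Bool}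
    (hU : IsUniversalPrefixMachine U) {x : ℕ → Bool} (hx : Incompressible U x)
    {μ : Measure (ℕ → Bool)} (hμ : IsTypical μ (doubled x)) (w : List Bool) :
    μ.real (cylinderSet (w ++ [false])) = μ.real (cylinderSet (w ++ [true])) := by
  have hlim : Tendsto (fun k : ℕ => 2 ^ 2 ^ (k + 2) + 2 ^ 2 ^ (k + 1) - 4) atTop atTop := by
    refine tendsto_atTop_mono (fun k => ?_) tendsto_id
    have h1 : k + 1 < 2 ^ (k + 1) := Nat.lt_two_pow_self
    have h2 : 2 ^ (k + 1) < 2 ^ 2 ^ (k + 1) := Nat.lt_two_pow_self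
    have h3 := two_pow_two_pow_succ (k + 1)
    rw [show k + 1 + 1 = k + 2 from rfl] at h3
    simp only [id]
    rcases Nat.lt_or_ge (2 ^ 2 ^ (k + 1)) 4 with h | h
    · omega
    · have := Nat.mul_le_mul_right (2 ^ 2 ^ (k + 1)) h
      omega
  have hdiff := (((hμ (w ++ [false])).comp hlim).sub ((hμ (w ++ [true])).comp hlim)).abs
  -- The limits exist, so it suffices to bound the difference of frequencies along the lengths N + P
  -- - 4.
  have hle : ∀ m : ℕ, 0 < m →
      |μ.real (cylinderSet (w ++ [false])) - μ.real (cylinderSet (w ++ [true]))| ≤ 2 / m := by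
    intro m hm
    refine le_of_tendsto hdiff ?_
    have hbal := (tendsto_add_atTop_nat 2).eventually
      (hx.eventually_imbalance_le hU w.reverse m)
    filter_upwards [hbal, eventually_ge_atTop (m * (4 * w.length + 16))] with k hk hkm
    have f := occurrences_doubled_le x k (w ++ [false])
    have t := occurrences_doubled_le x k (w ++ [true])
    have hP : m * (4 * w.length + 16) ≤ 2 ^ 2 ^ (k + 1) := by
      have h1 : k + 1 < 2 ^ (k + 1) := Nat.lt_two_pow_self
      have h2 : 2 ^ (k + 1) < 2 ^ 2 ^ (k + 1) := Nat.lt_two_pow_self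
      omega
    have hN := two_pow_two_pow_succ (k + 1)
    rw [show k + 1 + 1 = k + 2 from rfl] at hN
    have hfd := hitCount_reverse_initial x w false (2 ^ 2 ^ (k + 2) - w.length)
    have htd := hitCount_reverse_initial x w true (2 ^ 2 ^ (k + 2) - w.length)
    simp only [Function.comp_apply]
    generalize 2 ^ 2 ^ (k + 2) = N at *
    generalize 2 ^ 2 ^ (k + 1) = P at *
    have hmP : 4 * w.length + 16 ≤ P := (Nat.le_mul_of_pos_left _ hm).trans hP
    have hPN : P ≤ N := by rw [hN]; exact Nat.le_mul_self _
    have hsub : N - w.length + w.length = N := by omega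
    rw [hsub] at hfd htd
    have sf := occurrences_add x (w ++ [false]) (N - w.length) w.length
    have st := occurrences_add x (w ++ [true]) (N - w.length) w.length
    have sf' := occurrences_le (fun i => x (N - w.length + i)) (w ++ [false]) w.length
    have st' := occurrences_le (fun i => x (N - w.length + i)) (w ++ [true]) w.length
    rw [hsub] at sf st
    simp only [List.length_append, List.length_singleton] at f t
    unfold imbalance at hk
    rw [hfd, htd] at hk
    set F := occurrences (doubled x) (w ++ [false]) (N + P - 4)
    set T := occurrences (doubled x) (w ++ [true]) (N + P - 4)
    have hFT : (F - T) + (T - F) ≤ (occurrences x (w ++ [false]) (N - w.length)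
        - occurrences x (w ++ [true]) (N - w.length) + (occurrences x (w ++ [true]) (N - w.length)
        - occurrences x (w ++ [false]) (N - w.length))) + (3 * P + 3 * w.length + 2) := by
      omega
    -- One N comes from the balance of `x`, the other from the O(P) error, since N = P² and P ≥ 4m.
    have hmul : m * ((F - T) + (T - F)) ≤ 2 * N := by
      have h1 := (Nat.mul_le_mul_left m hFT)
      rw [mul_add m _ (3 * P + 3 * w.length + 2)] at h1
      have h2 : m * (3 * P + 3 * w.length + 2) ≤ N := by
        rw [hN]
        calc m * (3 * P + 3 * w.length + 2) ≤ m * (4 * P) := Nat.mul_le_mul_left _ (by omega)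
          _ = (m * 4) * P := by ring
          _ ≤ P * P := Nat.mul_le_mul_right _ (le_trans (by nlinarith) hP)
      omega
    have hN' : 2 * N ≤ 2 * (N + P - 4) := by omega
    have hpos : 0 < N + P - 4 := by omega
    have habs : |(F : ℝ) - T| = ((F - T + (T - F) : ℕ) : ℝ) := by
      rcases le_total F T with h | h
      · rw [abs_of_nonpos (by simpa using h), Nat.sub_eq_zero_of_le h]
        push_cast [h]; ring
      · rw [abs_of_nonneg (by simpa using h), Nat.sub_eq_zero_of_le h]
        push_cast [h]; ring
    have hpos' : (0 : ℝ) < ((N + P - 4 : ℕ) : ℝ) := by exact_mod_cast hpos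
    rw [← sub_div, abs_div, abs_of_pos hpos', habs, div_le_div_iff₀ hpos' (by exact_mod_cast hm)]
    rw [mul_comm]
    exact_mod_cast hmul.trans hN'
  have h0 : |μ.real (cylinderSet (w ++ [false])) - μ.real (cylinderSet (w ++ [true]))| ≤ 0 := by
    refine ge_of_tendsto (tendsto_const_div_atTop_nhds_zero_nat 2) ?_
    filter_upwards [eventually_gt_atTop 0] with m hm using hle m hm
  exact sub_eq_zero.1 (abs_nonpos_iff.1 h0)

/-! ### The number of pairs of an LZ77 parsing -/

/-- The binary words of length at most `t`. -/
def shortWords (t : ℕ) : Finset (List Bool) := ((List.range (t + 1)).flatMap words).toFinset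

theorem mem_shortWords {t : ℕ} {v : List Bool} : v ∈ shortWords t ↔ v.length ≤ t := by
  simp [shortWords, mem_words]

theorem card_shortWords_le (t : ℕ) : (shortWords t).card ≤ 2 ^ (t + 1) := by
  refine (List.toFinset_card_le _).trans ?_
  induction t with
  | zero => simp [words]
  | succ t ih =>
    rw [List.range_succ, List.flatMap_append, List.length_append, pow_succ]
    simp only [List.flatMap_singleton, length_words]
    omega

/-- The number of words of length at most `t` that do not occur in `d`. -/
def missing (t : ℕ) (d : List Bool) : ℕ := ((shortWords t).filter fun v => ¬ v <:+: d).card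

theorem missing_le (t : ℕ) (d : List Bool) : missing t d ≤ 2 ^ (t + 1) :=
  (Finset.card_filter_le _ _).trans (card_shortWords_le t)

theorem missing_anti (t : ℕ) {d d' : List Bool} (h : d <:+: d') :
    missing t d' ≤ missing t d :=
  Finset.card_le_card (Finset.monotone_filter_right _ fun _ _ hv hv' => hv (hv'.trans h))

theorem missing_lt {t : ℕ} {d d' v : List Bool} (h : d <:+: d') (hvt : v.length ≤ t)
    (hv : ¬ v <:+: d) (hv' : v <:+: d') : missing t d' < missing t d := by
  refine Finset.card_lt_card (Finset.ssubset_iff_of_subset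
    (Finset.monotone_filter_right _ fun _ _ hv hv' => hv (hv'.trans h)) |>.2 ⟨v, ?_, ?_⟩)
  · simp [mem_shortWords, hvt, hv]
  · simp [hv']

theorem LZ77Parse.eq_nil {d ps} (h : LZ77Parse d [] ps) : ps = [] := by
  generalize hr : ([] : List Bool) = r at h
  cases h with
  | nil => rfl
  | literal => simp at hr
  | copy _ v rest p ps hv => exact absurd (List.append_eq_nil_iff.1 hr.symm).1 hv

/-- A remaining word that occurs in the part already parsed is represented by one pair. -/
theorem LZ77Parse.length_le_one {d r ps} (h : LZ77Parse d r ps) (hr : r <:+: d) :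
    ps.length ≤ 1 := by
  cases h with
  | nil => simp
  | literal _ a rest ps ha h => exact absurd (hr.subset (by simp)) ha
  | copy _ v rest p ps hv hp hmax h =>
    cases rest with
    | nil => simp [h.eq_nil]
    | cons a rest =>
      -- If letters remained, the copied word could have been extended by `a`, against maximality.
      refine absurd (List.IsInfix.trans ?_ hr) (hmax a (by simp))
      exact List.IsPrefix.isInfix ⟨rest, by simp⟩

/-- If, as soon as `n` letters have been parsed, the remaining word occurs in the part already
parsed, then the number of pairs is at most `n / t` up to a term that depends on `t` only. -/
theorem LZ77Parse.mul_length_le {t n : ℕ} (ht : 1 ≤ t) {d r ps} (h : LZ77Parse d r ps)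
    (hW : ∀ e v, e ++ v = d ++ r → n ≤ e.length → v <:+: e) :
    t * ps.length
      ≤ t * (missing t d + missing t (d ++ r.take 1)) + (n - d.length) + 2 * t := by
  -- The sum of the two `missing` counts is a potential. A short copy `v` makes `v ++ [a]` occur
  -- only once the next letter `a` is included, so the count is tracked both at the end of the
  -- parsed part and one letter later. The term `2 * t` pays for the pair that crosses `n` or ends
  -- the word, and for one pair after it.
  induction h with
  | nil => simp
  | literal d a rest ps ha h ih =>
    have ih := ih fun e v hev => hW e v (by simpa using hev)
    have h1 : missing t (d ++ [a]) < missing t d :=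
      missing_lt (v := [a]) (List.prefix_append _ _).isInfix (by simpa using ht)
        (fun hi => ha (hi.subset (by simp))) (List.suffix_append _ _).isInfix
    have h2 : missing t (d ++ [a] ++ rest.take 1) ≤ missing t (d ++ [a]) :=
      missing_anti t (List.prefix_append _ _).isInfix
    have h3 : t * (missing t (d ++ [a]) + missing t (d ++ [a] ++ rest.take 1)) + t
        ≤ t * (missing t d + missing t (d ++ (a :: rest).take 1)) := by
      rw [← Nat.mul_succ]
      refine Nat.mul_le_mul_left _ ?_
      simp only [List.take_succ_cons, List.take_zero]
      omega
    rw [List.length_cons, Nat.mul_succ]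
    simp only [List.length_append] at ih
    omega
  | copy d v rest p ps hv hp hmax h ih =>
    have ih := ih fun e v hev => hW e v (by simpa using hev)
    rcases Nat.lt_or_ge d.length n with hdn | hdn
    swap
    · have h1 : ((p + 1, v.length) :: ps).length ≤ 1 :=
        (LZ77Parse.copy d v rest p ps hv hp hmax h).length_le_one (hW _ _ rfl hdn)
      have h2 := Nat.mul_le_mul_left t h1
      omega
    cases rest with
    | nil => simp only [h.eq_nil, List.length_singleton]; omega
    | cons a rest =>
      have h2 : missing t (d ++ v) ≤ missing t (d ++ (v ++ a :: rest).take 1) := by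
        refine missing_anti t (List.IsPrefix.isInfix ?_)
        rw [List.prefix_append_right_inj, List.take_append_of_le_length]
        · exact List.take_prefix _ _
        · exact List.length_pos_iff.2 hv
      have h3 : d <:+: d ++ v ++ [a] := List.IsPrefix.isInfix ⟨v ++ [a], by simp⟩
      simp only [List.take_succ_cons, List.take_zero] at ih
      rw [List.length_cons, Nat.mul_succ]
      rcases Nat.lt_or_ge v.length t with hvt | hvt
      -- Short copy: the potential drops by at least one.
      · have h1 : missing t (d ++ v ++ [a]) < missing t d :=
          missing_lt (v := v ++ [a]) h3 (by simpa using hvt) (hmax a (by simp))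
            (List.IsSuffix.isInfix ⟨d, by simp⟩)
        have h4 : t * (missing t (d ++ v) + missing t (d ++ v ++ [a])) + t
            ≤ t * (missing t d + missing t (d ++ (v ++ a :: rest).take 1)) := by
          rw [← Nat.mul_succ]
          exact Nat.mul_le_mul_left _ (by omega)
        simp only [List.length_append] at ih
        omega
      -- Long copy: the potential does not grow, and `n - d.length` drops by at least `t` unless `n`
      -- is crossed.
      · have h4 : t * (missing t (d ++ v) + missing t (d ++ v ++ [a]))
            ≤ t * (missing t d + missing t (d ++ (v ++ a :: rest).take 1)) := by
          have := missing_anti t h3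
          exact Nat.mul_le_mul_left _ (by omega)
        rcases Nat.lt_or_ge n (d ++ v).length with hn | hn
        · have h1 : ps.length ≤ 1 :=
            h.length_le_one (hW _ _ (by simp) hn.le)
          have h5 := Nat.mul_le_mul_left t h1
          omega
        · simp only [List.length_append] at ih hn
          omega

/-! ### The length of the codeword -/

theorem encodePairs_cons (C : ℕ → List Bool) (q : ℕ × ℕ) (ps : List (ℕ × ℕ)) :
    (encodePairs C (q :: ps)).length
      = (C q.1).length + (C q.2).length + (encodePairs C ps).length := by
  simp [encodePairs, add_assoc]

/-- Positions are charged uniformly by `A`. Lengths are charged linearly, because the lengths of the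
copied words sum to at most the length of the parsed word. The factor 8 keeps the bounds integral.
-/
theorem LZ77Parse.length_encodePairs_le {C : ℕ → List Bool} {n A c : ℕ}
    (hA : ∀ m ≤ n, 8 * (C m).length ≤ A) (hc : ∀ m, 8 * (C m).length ≤ m + c) {d r ps}
    (h : LZ77Parse d r ps) (hn : d.length + r.length ≤ n) :
    8 * (encodePairs C ps).length ≤ ps.length * (A + c) + r.length := by
  induction h with
  | nil => simp [encodePairs]
  | literal d a rest ps ha h ih =>
    simp only [List.length_append, List.length_cons, List.length_nil] at ih hn
    have h0 := ih (by omega)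
    have h1 := hA 0 (by omega)
    have h2 := hc a.toNat
    have h3 := a.toNat_le
    rw [encodePairs_cons, List.length_cons, List.length_cons, Nat.succ_mul ps.length]
    dsimp only
    omega
  | copy d v rest p ps hv hp hmax h ih =>
    simp only [List.length_append] at ih hn
    have h0 := ih (by omega)
    have hpd : p + 1 ≤ d.length := by
      have h1 := hp.length_le
      have h2 := List.length_pos_iff.2 hv
      rw [List.length_drop] at h1
      omega
    have h1 := hA (p + 1) (by omega)
    have h2 := hc v.length
    rw [encodePairs_cons, List.length_cons, Nat.succ_mul ps.length, List.length_append]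
    dsimp only
    omega

/-- A tangent bound at 256, weakened by log 2 ≥ 1/2. The slope is small enough for the double
logarithm in the code length to fit into the slack between 8j and 9j. -/
theorem logb_two_le {x : ℝ} (hx : 0 < x) : Real.logb 2 x ≤ x / 128 + 8 := by
  have h1 : Real.log (x / 256) ≤ x / 256 - 1 := Real.log_le_sub_one_of_pos (by positivity)
  have h2 : Real.logb 2 x = Real.logb 2 (x / 256) + 8 := by
    rw [Real.logb_div hx.ne' (by norm_num), show (256 : ℝ) = 2 ^ (8 : ℕ) by norm_num,
      Real.logb_pow, Real.logb_self_eq_one (by norm_num)]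
    norm_num
  have h3 := Real.log_two_gt_d9
  have h4 : Real.logb 2 (x / 256) ≤ x / 128 := by
    rw [Real.logb, div_le_iff₀ (by linarith)]
    nlinarith
  linarith

theorem IsIntegerCode.exists_length_le {C : ℕ → List Bool} (hC : IsIntegerCode C) :
    ∃ c : ℕ, (∀ m, 8 * (C m).length ≤ m + c) ∧
      ∀ j m, m ≤ 2 ^ j → 8 * (C m).length ≤ 9 * j + c := by
  obtain ⟨-, c, hc⟩ := hC
  have hup : ∀ m : ℕ, 1 ≤ m → ∀ b : ℝ, Real.logb 2 ((m : ℝ) + 1) ≤ b →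
      ((C m).length : ℝ) ≤ Real.logb 2 m + 2 * (b / 128 + 8) + c := by
    intro m hm b hb
    have hm' : (1 : ℝ) ≤ m := by exact_mod_cast hm
    have h1 := (abs_le.1 (hc m hm)).2
    have h2 : 1 ≤ Real.logb 2 ((m : ℝ) + 1) := by
      rw [Real.le_logb_iff_rpow_le (by norm_num) (by linarith)]
      norm_num
      linarith
    have h3 := Real.logb_le_logb_of_le (b := 2) (by norm_num) (by linarith) hb
    have h4 := logb_two_le (show 0 < b by linarith)
    linarith
  -- The length estimate for `C` starts at 1, so the codeword of 0 is added by hand.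
  refine ⟨⌈8 * c⌉₊ + 300 + 8 * (C 0).length, fun m => ?_, fun j m hmj => ?_⟩
  · rcases Nat.eq_zero_or_pos m with rfl | hm
    · omega
    · have hm' : (1 : ℝ) ≤ m := by exact_mod_cast hm
      have h1 := hup m hm m (by
        rw [Real.logb_le_iff_le_rpow (by norm_num) (by linarith), Real.rpow_natCast]
        exact_mod_cast Nat.lt_two_pow_self (n := m))
      have h2 := logb_two_le (show (0 : ℝ) < m by linarith)
      have h3 := Nat.le_ceil (8 * c)
      have h4 : (8 : ℝ) * (C m).length ≤ m + (⌈8 * c⌉₊ + 300) := by linarith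
      have h5 : 8 * (C m).length ≤ m + (⌈8 * c⌉₊ + 300) := by exact_mod_cast h4
      omega
  · rcases Nat.eq_zero_or_pos m with rfl | hm
    · omega
    · have hm' : (1 : ℝ) ≤ m := by exact_mod_cast hm
      have hmj' : (m : ℝ) ≤ 2 ^ j := by exact_mod_cast hmj
      have h1 := hup m hm (j + 1) (by
        rw [Real.logb_le_iff_le_rpow (by norm_num) (by linarith)]
        rw [show ((j : ℝ) + 1) = ((j + 1 : ℕ) : ℝ) by push_cast; rfl, Real.rpow_natCast, pow_succ]
        linarith)
      have h2 : Real.logb 2 m ≤ j := by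
        rw [Real.logb_le_iff_le_rpow (by norm_num) (by linarith), Real.rpow_natCast]
        exact hmj'
      have h3 := Nat.le_ceil (8 * c)
      have h4 : (8 : ℝ) * (C m).length ≤ 9 * j + (⌈8 * c⌉₊ + 300) := by
        have : (0 : ℝ) ≤ j := by positivity
        linarith
      have h5 : 8 * (C m).length ≤ 9 * j + (⌈8 * c⌉₊ + 300) := by exact_mod_cast h4
      omega

/-! ### The test rejects the doubled sequence -/

/-- In every splitting of `u₀ u₀ … u_k u_k` after the first copy of `u_k`, the second part occurs
in the first. -/
theorem isInfix_of_append_eq_doubledWord {x : ℕ → Bool} {k : ℕ} {e v : List Bool}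
    (h : e ++ v = doubledWord x (k + 1))
    (he : (doubledWord x k ++ blockU x (k + 1)).length ≤ e.length) : v <:+: e := by
  rw [doubledWord_succ] at h
  have h1 : doubledWord x k ++ blockU x (k + 1) <+: e :=
    List.prefix_of_prefix_length_le ⟨_, rfl⟩ ⟨v, h⟩ he
  obtain ⟨w, rfl⟩ := h1
  rw [List.append_assoc, List.append_cancel_left_eq] at h
  have h2 : v <:+: blockU x (k + 1) := List.IsSuffix.isInfix ⟨w, h⟩
  exact h2.trans (List.IsInfix.trans (List.suffix_append _ _).isInfix
    (List.prefix_append _ _).isInfix)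

theorem linear_le_two_pow {i : ℕ} (hi : 13 ≤ i) : 380 * i ≤ 2 ^ i := by
  induction i, hi using Nat.le_induction with
  | base => norm_num
  | succ i _ ih => rw [pow_succ]; omega

/-- Used with i = 2^k, q = 2^i, t = 3i and `s` pairs, for a word of 2(q⁴ - 2) letters. To leading
order s ≤ q⁴/(3i), so the cost is at most (36/24 + 2/8)q⁴ = (7/4)q⁴ < 2q⁴. -/
theorem length_add_le_of_parse_bounds {i q s cost c R : ℕ} (hq : 380 * i ≤ q) (hi : c + R + 13 ≤ i)
    (hs : 3 * i * s ≤ 3 * i * (4 * q ^ 3) + (q ^ 4 + q ^ 2) + 6 * i)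
    (hcost : 8 * cost ≤ s * (36 * i + c) + 2 * (q ^ 4 - 2)) :
    cost + R ≤ 2 * (q ^ 4 - 2) := by
  have hq1 : 380 ≤ q := by omega
  have hq4 : q ≤ q ^ 4 := Nat.le_self_pow (by norm_num) q
  obtain ⟨n, hn⟩ : ∃ n, q ^ 4 = n + 2 := ⟨q ^ 4 - 2, by omega⟩
  have h1 : 20 * (3 * i * s) ≤ 21 * q ^ 4 := by
    have e1 : q ^ 2 ≤ i * q ^ 3 := by
      calc q ^ 2 ≤ q ^ 3 := Nat.pow_le_pow_right (by omega) (by norm_num)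
        _ ≤ i * q ^ 3 := Nat.le_mul_of_pos_left _ (by omega)
    have e2 : 6 * i ≤ 6 * (i * q ^ 3) :=
      Nat.mul_le_mul_left _ (Nat.le_mul_of_pos_right _ (by positivity))
    -- The lower-order terms total at most (12 + 1 + 6) i q³, and 380 = 20 · 19 makes this at most
    -- q⁴/20.
    have e3 : 380 * i * q ^ 3 ≤ q * q ^ 3 := Nat.mul_le_mul_right _ hq
    have e4 : q * q ^ 3 = q ^ 4 := by ring
    nlinarith
  have h2 : 3 * i * (8 * cost) ≤ 3 * i * s * (37 * i) + 6 * i * n := by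
    have e1 : s * (36 * i + c) ≤ s * (37 * i) := Nat.mul_le_mul_left _ (by omega)
    have e2 : 8 * cost ≤ s * (37 * i) + 2 * n := by omega
    calc 3 * i * (8 * cost) ≤ 3 * i * (s * (37 * i) + 2 * n) := Nat.mul_le_mul_left _ e2
      _ = _ := by ring
  have h3 : 20 * (3 * i * s * (37 * i)) ≤ 777 * (i * (n + 2)) := by
    calc 20 * (3 * i * s * (37 * i)) = 20 * (3 * i * s) * (37 * i) := by ring
      _ ≤ 21 * q ^ 4 * (37 * i) := Nat.mul_le_mul_right _ h1
      _ = _ := by rw [hn]; ring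
  have h4 : i * (480 * cost) ≤ i * (777 * (n + 2) + 120 * n) := by nlinarith
  have h5 := Nat.le_of_mul_le_mul_left h4 (by omega)
  rw [hn]
  omega

theorem eventually_rejects_doubled {C : ℕ → List Bool} (hC : IsIntegerCode C)
    {φ : List Bool → List Bool} (hφ : IsLZ77Code C φ) (x : ℕ → Bool) (α : ℝ) :
    ∀ᶠ k : ℕ in atTop, Rejects φ α (initial (doubled x) (2 * (2 ^ 2 ^ (k + 1) - 2))) := by
  obtain ⟨c, hc1, hc2⟩ := hC.exists_length_le
  filter_upwards [eventually_ge_atTop (2 * c + 9 + ⌈-Real.logb 2 α⌉₊ + 14)] with k' hk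
  obtain ⟨k, rfl⟩ : ∃ k, k' = k + 1 := ⟨k' - 1, by omega⟩
  rw [initial_doubled]
  obtain ⟨ps, hps, he⟩ := hφ (doubledWord x (k + 1))
  have hi : k < 2 ^ k := Nat.lt_two_pow_self
  have hN : 2 ^ 2 ^ (k + 2) = (2 ^ 2 ^ k) ^ 4 := by rw [← pow_mul, pow_add]; norm_num
  have hP : 2 ^ 2 ^ (k + 1) = (2 ^ 2 ^ k) ^ 2 := by rw [← pow_mul, pow_succ]
  have hlen := length_doubledWord x (k + 1)
  rw [show k + 1 + 1 = k + 2 from rfl, hN] at hlen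
  have hlen' : (doubledWord x k ++ blockU x (k + 1)).length
      ≤ (2 ^ 2 ^ k) ^ 4 + (2 ^ 2 ^ k) ^ 2 := by
    rw [List.length_append, length_doubledWord, length_blockU, show k + 1 + 1 = k + 2 from rfl,
      hN, hP]
    have : (2 ^ 2 ^ k) ^ 2 ≤ (2 ^ 2 ^ k) ^ 4 :=
      Nat.pow_le_pow_right (by positivity) (by norm_num)
    omega
  -- The word length is about 2^(4i) with i = 2^k. The threshold 3i lies below 4i, so short words
  -- are negligible, and above (18/7)i, so the cost stays below the word length.
  have h1 := hps.mul_length_le (t := 3 * 2 ^ k)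
    (n := (doubledWord x k ++ blockU x (k + 1)).length) (by omega)
    fun e v hev => isInfix_of_append_eq_doubledWord (by simpa using hev)
  have h2 := hps.length_encodePairs_le (n := 2 ^ (4 * 2 ^ k + 1))
    (A := 9 * (4 * 2 ^ k + 1) + c) (fun m hm => hc2 _ m hm) hc1 (by
      rw [hlen, pow_succ 2 (4 * 2 ^ k), mul_comm 4 (2 ^ k), pow_mul]
      simp only [List.length_nil]
      omega)
  rw [hlen] at h2
  have hpow : 2 ^ (3 * 2 ^ k + 1) = 2 * (2 ^ 2 ^ k) ^ 3 := by
    rw [pow_succ, mul_comm 3, pow_mul, mul_comm]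
  have m1 := missing_le (3 * 2 ^ k) []
  have m2 := missing_le (3 * 2 ^ k) ([] ++ (doubledWord x (k + 1)).take 1)
  rw [hpow] at m1 m2
  have h3 := linear_le_two_pow (i := 2 ^ k) (by omega)
  have h4 : (encodePairs C ps).length + ⌈-Real.logb 2 α⌉₊ ≤ (doubledWord x (k + 1)).length := by
    rw [hlen]
    refine length_add_le_of_parse_bounds (s := ps.length) (c := 2 * c + 9) h3 (by omega) ?_ ?_
    · have h5 := Nat.mul_le_mul_left (3 * 2 ^ k) (Nat.add_le_add m1 m2)
      simp only [List.length_nil, Nat.sub_zero] at h1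
      rw [show 2 * (2 ^ 2 ^ k) ^ 3 + 2 * (2 ^ 2 ^ k) ^ 3 = 4 * (2 ^ 2 ^ k) ^ 3 by ring] at h5
      omega
    · refine h2.trans_eq ?_
      ring
  have h5 := Nat.le_ceil (-Real.logb 2 α)
  have h6 : ((encodePairs C ps).length : ℝ) + ⌈-Real.logb 2 α⌉₊ ≤ (doubledWord x (k + 1)).length :=
    by exact_mod_cast h4
  rw [Rejects, he]
  linarith

end LZTest

theorem mainTheorem4
    (U : List Bool →. List Bool) (hU : IsUniversalPrefixMachine U)
    (C : ℕ → List Bool) (hC : IsIntegerCode C)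
    (φ : List Bool → List Bool) (hφ : IsLZ77Code C φ)
    (x : ℕ → Bool) (hx : Incompressible U x) :
    (∀ μ : Measure (ℕ → Bool), IsStationaryErgodic μ → μ ≠ fairCoin →
        ¬ IsTypical μ (doubled x)) ∧
      ∀ α : ℝ, 0 < α → α < 1 →
        ∀ᶠ k : ℕ in atTop, Rejects φ α (initial (doubled x) (2 * (2 ^ 2 ^ (k + 1) - 2))) := by
  refine ⟨fun μ hμ hne htyp => hne ?_, fun α _ _ => eventually_rejects_doubled hC hφ x α⟩
  have := hμ.1
  exact eq_fairCoin (measureReal_cylinderSet_of_isTypical hU hx htyp)
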